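/- **Setting.** Let $\mathcal X$ be a measurable space, $\mathcal Y$ a finite label set, and $\Phi$ a (possibly infinite) set of measurable features $\phi:\mathcal X\to\{\text{true},\text{false}\}$ closed under negation. A *representation of size $m$* consists of $m$ components $G_1,\dots,G_m\subseteq\mathcal X$ covering $\mathcal X$, labels $\ell(G_i)\in\mathcal Y$, a fixed measurable choice $G(x)\ni x$ of a component for every $x$, and, for all $i,j$ with $\ell(G_i)\ne\ell(G_j)$, a feature $\phi(G_i,G_j)\in\Phi$ that is true on $G_i$ and false on $G_j$, with $\phi(G_j,G_i)=\neg\phi(G_i,G_j)$. Put $c^*(x)=\ell(G(x))$. A *stochastic stream with exception rate at most $\epsilon$* is an i.i.d. sequence of triples $(x_t,y_t,\mathrm{Ex}_t)_{t\ge0}$, where $(x_t,y_t)\in\mathcal X\times\mathcal Y$ and $\mathrm{Ex}_t$ is the event of an exception, such that $\Pr[\mathrm{Ex}_t]\le\epsilon$ and $y_t=c^*(x_t)$ unless $\mathrm{Ex}_t$ occurs. Let $\mathcal D$ be the law of $(x_t,y_t)$. A *feature discovery protocol* is first given $(x_0,y_0)$. In each later round $t$ it sees $x_t$, chooses an earlier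 instance $x_s$ ($s<t$) as explanation, and predicts $y_s$. If $y_s\neq y_t$ (a *mistake*), the teacher reveals $y_t$ and a feature of $\Phi$; this feature is $\phi(G(x_t),G(x_s))$ if neither time $t$ nor time $s$ is exceptional, and is arbitrary (possibly adversarial) otherwise. Before any round the protocol may stop and output a feature set $\hat\Phi$. The protocol is not told $\Phi$, the representation or the distribution of the stream. Let $\mathrm{err}(h,\mathcal D)=\Pr_{(X,Y)\sim\mathcal D}[h(X)\ne Y]$ and $\mathrm{err}(\mathcal H,\mathcal D)=\inf_{h\in\mathcal H}\mathrm{err}(h,\mathcal D)$. For a set $\Phi'$ of features let $\mathcal H^+_{\Phi'}\subseteq\mathcal Y^{\mathcal X}$ be the class of all functions given by a decision list with at most $m$ rules, each rule being a conjunction of at most $m-1$ features from $\Phi'$ with an associated label in $\mathcal Y$; the first satisfied rule determines the label, and every $x\in\mathcal X$ must satisfy some rule. The setting with representation size $m$ and class $\mathcal H^+$ has *$\alpha$-Feature Influence with exception rate $\epsilon$, confidence $\delta$, mistake bound $b\in\mathbb N$ and capacity bound $d$* if there is a feature discovery protocol such that for every $\Phi$, every representation of size $m$ over $\Phi$, and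 every stochastic stream consistent with it with exception rate at most $\epsilon$: 1. the protocol never makes more than $b$ mistakes; 2. almost surely it stops after finitely many rounds, and its output satisfies $\hat\Phi\subseteq\Phi$ and $\log_2|\mathcal H^+_{\hat\Phi}|\le d$; 3. with probability at least $1-\delta$, $\mathrm{err}(\mathcal H^+_{\hat\Phi},\mathcal D)\le\epsilon+\alpha$. **Theorem.** For every $m$ and all $\beta,\delta,\epsilon\in(0,1)$, the Discriminative Feature Feedback setting with representation size $m$ and class $\mathcal H^+$ has $\frac{\sqrt\beta\,m^2}{2}$-Feature Influence with exception rate $\epsilon$, confidence $\delta$, mistake bound $\max\{0,\lfloor 12\ln(1/(2\delta\beta))/\beta\rfloor\}$ and capacity bound $$m\log_2\max\{m,|\mathcal Y|\}+m^2\log_2(3/\beta).$$ In particular, if $|\mathcal Y|\le m$, the capacity bound is $m\log_2 m+m^2\log_2(3/\beta)$. -/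

import Mathlib

open MeasureTheory ProbabilityTheory

universe u v w

/-- Binary features are Boolean predicates on the domain; `Feature.neg φ` is the negation of `φ`. -/
def Feature.neg {X : Type u} (φ : X → Bool) : X → Bool := fun x => !φ x

/-- A component representation of size `m` over the feature set `Φ`: components `comp i` covering
the domain, with labels, a fixed choice `idx x` of (the index of) a component containing `x`, and a
fixed choice `disc i j ∈ Φ` of a discriminative feature for any two components whose labels
differ. -/
structure ComponentRepresentation {X : Type u} (Y : Type v) [MeasurableSpace X]
    (Φ : Set (X → Bool)) (m : ℕ) where
  comp : Fin m → Set X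
  label : Fin m → Y
  idx : X → Fin m
  mem_comp_idx : ∀ x, x ∈ comp (idx x)
  measurable_idx : Measurable idx
  disc : Fin m → Fin m → X → Bool
  disc_mem : ∀ i j, label i ≠ label j → disc i j ∈ Φ
  disc_neg : ∀ i j, label i ≠ label j → disc j i = Feature.neg (disc i j)
  disc_of_mem_left : ∀ i j, label i ≠ label j → ∀ x ∈ comp i, disc i j x = true
  disc_of_mem_right : ∀ i j, label i ≠ label j → ∀ x ∈ comp j, disc i j x = false

/-- The target concept `c*(x) = ℓ(G(x))` induced by a representation. -/
def ComponentRepresentation.concept {X : Type u} {Y : Type v} [MeasurableSpace X]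
    {Φ : Set (X → Bool)} {m : ℕ} (R : ComponentRepresentation Y Φ m) (x : X) : Y :=
  R.label (R.idx x)

/-- A stochastic stream consistent with the representation `R`, except for an exception rate of at
most `ε`. At time `t` the labeled example is `(x t, y t)`, and `exc t` is the event that an
exception occurs at time `t`; these triples are i.i.d. In a round without exception the label is
that of the target concept; in an exceptional round the example and the label are unrestricted.

`feedback t s ω` is the feature that the teacher gives at time `t` if the learner then makes a
mistake and its explanation was the instance observed at time `s`. If neither time is exceptional,
it is the discriminative feature of the two components. Otherwise it is an arbitrary
feature, which may depend in any way on `ω`, hence on everything that was observed, and on the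
learner, since streams will be quantified after the learner. -/
structure DFFStream {X : Type u} {Y : Type v} [MeasurableSpace X] [MeasurableSpace Y]
    {Φ : Set (X → Bool)} {m : ℕ} (R : ComponentRepresentation Y Φ m) (ε : ℝ)
    {Ω : Type w} [MeasurableSpace Ω] (P : Measure Ω) where
  x : ℕ → Ω → X
  y : ℕ → Ω → Y
  exc : ℕ → Ω → Prop
  measurable_x : ∀ t, Measurable (x t)
  measurable_y : ∀ t, Measurable (y t)
  measurable_exc : ∀ t, Measurable (exc t)
  indep : iIndepFun (fun t ω => (x t ω, y t ω, exc t ω)) P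
  identDistrib : ∀ t, IdentDistrib (fun ω => (x t ω, y t ω, exc t ω))
    (fun ω => (x 0 ω, y 0 ω, exc 0 ω)) P P
  exc_rate : P {ω | exc 0 ω} ≤ ENNReal.ofReal ε
  label_eq : ∀ t ω, ¬ exc t ω → y t ω = R.concept (x t ω)
  feedback : ℕ → ℕ → Ω → X → Bool
  feedback_mem : ∀ t s ω, feedback t s ω ∈ Φ
  feedback_eq : ∀ t s ω, ¬ exc t ω → ¬ exc s ω → R.concept (x t ω) ≠ R.concept (x s ω) →
    feedback t s ω = R.disc (R.idx (x t ω)) (R.idx (x s ω))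

/-- The distribution `𝒟` over labeled examples induced by a stream. -/
noncomputable def DFFStream.dist {X : Type u} {Y : Type v} [MeasurableSpace X] [MeasurableSpace Y]
    {Φ : Set (X → Bool)} {m : ℕ} {R : ComponentRepresentation Y Φ m} {ε : ℝ}
    {Ω : Type w} [MeasurableSpace Ω] {P : Measure Ω} (S : DFFStream R ε P) : Measure (X × Y) :=
  P.map (fun ω => (S.x 0 ω, S.y 0 ω))

/-- What the learner has seen in one round once the round is over: the example, its label (known
in any case: either the prediction was correct or the teacher gave the label), and the feature
that the teacher gave, which is `none` unless the prediction was incorrect. -/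
structure Round (X : Type u) (Y : Type v) where
  x : X
  y : Y
  feature : Option (X → Bool)

/-- A feature discovery protocol. A history lists the past rounds in chronological order. Before
each round the protocol may stop and output a set of features. Otherwise it gets a new instance,
chooses a previously observed instance as explanation, and predicts the label that was observed
with that instance. (In the very first round nothing has been observed yet: there is no prediction,
and the learner is just given the labeled example.) -/
structure FeatureDiscoveryProtocol (X : Type u) (Y : Type v) where
  halts : List (Round X Y) → Prop
  output : List (Round X Y) → Set (X → Bool)
  explain : (h : List (Round X Y)) → h ≠ [] → X → Fin h.length

open Classical in
/-- The history of the interaction of the protocol `A` with the stream `S` after a given number of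
rounds. It is also defined beyond the time at which `A` stops, where it is not used. -/
noncomputable def FeatureDiscoveryProtocol.history {X : Type u} {Y : Type v}
    [MeasurableSpace X] [MeasurableSpace Y]
    {Φ : Set (X → Bool)} {m : ℕ} {R : ComponentRepresentation Y Φ m} {ε : ℝ}
    {Ω : Type w} [MeasurableSpace Ω] {P : Measure Ω}
    (A : FeatureDiscoveryProtocol X Y) (S : DFFStream R ε P) (ω : Ω) : ℕ → List (Round X Y)
  | 0 => []
  | t + 1 =>
    let h := A.history S ω t
    h ++ [{ x := S.x t ω
            y := S.y t ω
            feature :=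
              if hne : h ≠ [] then
                let s := A.explain h hne (S.x t ω)
                if (h.get s).y = S.y t ω then none else some (S.feedback t s ω)
              else none }]

/-- The number of mistakes in a history. -/
def mistakes {X : Type u} {Y : Type v} (h : List (Round X Y)) : ℕ :=
  h.countP (fun r => r.feature.isSome)

/-- The protocol `A` has not stopped before having seen `n` rounds. -/
def FeatureDiscoveryProtocol.Reaches {X : Type u} {Y : Type v}
    [MeasurableSpace X] [MeasurableSpace Y]
    {Φ : Set (X → Bool)} {m : ℕ} {R : ComponentRepresentation Y Φ m} {ε : ℝ}
    {Ω : Type w} [MeasurableSpace Ω] {P : Measure Ω}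
    (A : FeatureDiscoveryProtocol X Y) (S : DFFStream R ε P) (ω : Ω) (n : ℕ) : Prop :=
  ∀ k < n, ¬ A.halts (A.history S ω k)

/-- The protocol `A` stops and outputs the set of features `F`. -/
def FeatureDiscoveryProtocol.Outputs {X : Type u} {Y : Type v}
    [MeasurableSpace X] [MeasurableSpace Y]
    {Φ : Set (X → Bool)} {m : ℕ} {R : ComponentRepresentation Y Φ m} {ε : ℝ}
    {Ω : Type w} [MeasurableSpace Ω] {P : Measure Ω}
    (A : FeatureDiscoveryProtocol X Y) (S : DFFStream R ε P) (ω : Ω) (F : Set (X → Bool)) : Prop :=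
  ∃ n, A.Reaches S ω n ∧ A.halts (A.history S ω n) ∧ F = A.output (A.history S ω n)

/-- The error of a prediction rule. -/
noncomputable def err {X : Type u} {Y : Type v} [MeasurableSpace X] [MeasurableSpace Y]
    (h : X → Y) (D : Measure (X × Y)) : ENNReal :=
  D {p | h p.1 ≠ p.2}

/-- The smallest error of a hypothesis class (`⊤` for the empty class). -/
noncomputable def classErr {X : Type u} {Y : Type v} [MeasurableSpace X] [MeasurableSpace Y]
    (H : Set (X → Y)) (D : Measure (X × Y)) : ENNReal :=
  ⨅ h ∈ H, err h D

/-- The Discriminative Feature Feedback setting with representation size `m` has `α`-Feature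
Influence, for the feature-based hypothesis class `Φ ↦ H Φ`, with exception rate `ε`, confidence
`δ`, mistake bound `b` and capacity bound `d`. The protocol is not told the feature set `Φ`.

The teacher's exceptional feedback need not be measurable in `ω`, so that "with probability at
least `1 - δ`" is stated in the strongest form: the outer measure of the complement is at most
`δ`. -/
def HasFeatureInfluence {X : Type u} {Y : Type v} [MeasurableSpace X] [MeasurableSpace Y]
    (H : Set (X → Bool) → Set (X → Y)) (m : ℕ) (α ε δ : ℝ) (b : ℕ) (d : ℝ) : Prop :=
  ∃ A : FeatureDiscoveryProtocol X Y,
    ∀ Φ : Set (X → Bool), (∀ φ ∈ Φ, Feature.neg φ ∈ Φ) → (∀ φ ∈ Φ, Measurable φ) →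
    ∀ (R : ComponentRepresentation Y Φ m)
      (Ω : Type w) [MeasurableSpace Ω] (P : Measure Ω) [IsProbabilityMeasure P]
      (S : DFFStream R ε P),
      (∀ ω n, A.Reaches S ω n → mistakes (A.history S ω n) ≤ b) ∧
      P {ω | ∃ F, A.Outputs S ω F ∧ classErr (H F) S.dist ≤ ENNReal.ofReal (ε + α)}ᶜ
        ≤ ENNReal.ofReal δ ∧
      ∀ᵐ ω ∂P, ∃ F, A.Outputs S ω F ∧ F ⊆ Φ ∧
        (H F).Finite ∧ Real.logb 2 ((H F).ncard : ℝ) ≤ d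

/-- A decision list: rules consisting of a conjunction of features and a label. -/
abbrev DecisionList (X : Type u) (Y : Type v) := List (List (X → Bool) × Y)

/-- The label of the first rule that `x` satisfies, if there is one. -/
def DecisionList.eval {X : Type u} {Y : Type v} (L : DecisionList X Y) (x : X) : Option Y :=
  (L.find? (fun r => r.1.all (fun φ => φ x))).map Prod.snd

/-- The class `ℋ⁺` of the concepts described by a decision list with at most `m` rules, each a
conjunction of at most `m - 1` features from `Φ` together with a label. The list has to determine
the label of every example. -/
def decisionListClass (X : Type u) (Y : Type v) (m : ℕ) (Φ : Set (X → Bool)) : Set (X → Y) :=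
  {h | ∃ L : DecisionList X Y, L.length ≤ m ∧
    (∀ r ∈ L, r.1.length ≤ m - 1 ∧ ∀ φ ∈ r.1, φ ∈ Φ) ∧ ∀ x, L.eval x = some (h x)}

/-! The protocol explains every instance by its predecessor and examines the disjoint pairs of
rounds `(2k, 2k+1)`, `k < N`. Let `q i` be the probability of a round without exception in component
`i`. Call two components with different labels heavy if `q i * q j ≥ β`. Such a pair shows up, in
either order and without exceptions, with probability `2 * q i * q j` per test, and then the teacher
must reveal its feature up to negation. Counting features up to negation and keeping those with
count at least `β * N` therefore finds all heavy pairs with high probability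
(`measure_count_pairs_lt_le`). Adversarial features can also pass the threshold, but each test
counts towards at most two features, so at most `2 / β` survive.

The failure probability for a heavy pair is at most `δ * 2 * q i * q j`, not merely a uniform bound.
These bounds sum to at most `δ * (∑ q i)^2 ≤ δ`, so the union bound costs no factor depending on
`m`.

The heavy features suffice (`exists_mem_decisionListClass`): list the components by decreasing
weight, each rule being the conjunction of its heavy features. An instance satisfies the rule of its
own component, so it can only be misclassified by an earlier, at least as heavy component that forms
a light pair with its own. Its component then has weight at most `√β`, and all such components
together weigh at most `m * √β`. -/

/-! ### Chernoff bound for disjoint consecutive pairs. -/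

section Probability

variable {Ω : Type*} {E : Type*} [MeasurableSpace Ω] [MeasurableSpace E] {P : Measure Ω}

/-- The moment generating function of a sum over disjoint consecutive pairs of an independent
sequence is the product of the moment generating functions. -/
theorem mgf_sum_consecutive_pairs {V : ℕ → Ω → E} (hV : ∀ t, Measurable (V t))
    (hind : iIndepFun V P) {g : E × E → ℝ} (hg : Measurable g) (t : ℝ) (n : ℕ) :
    mgf (∑ k ∈ Finset.range n, fun ω => g (V (2 * k) ω, V (2 * k + 1) ω)) P t =
      ∏ k ∈ Finset.range n, mgf (fun ω => g (V (2 * k) ω, V (2 * k + 1) ω)) P t := by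
  have hP := hind.isProbabilityMeasure
  have hX : ∀ k, Measurable (fun ω => g (V (2 * k) ω, V (2 * k + 1) ω)) :=
    fun k => hg.comp ((hV _).prodMk (hV _))
  induction n with
  | zero => simp
  | succ n ih =>
    rw [Finset.sum_range_succ, Finset.prod_range_succ, ← ih]
    -- The partial sum depends only on the coordinates below `2 * n`, the new summand only on the
    -- next two; disjoint blocks of coordinates are independent.
    have hdisj : Disjoint (Finset.range (2 * n)) {2 * n, 2 * n + 1} := by
      rw [Finset.disjoint_left]
      intro a ha
      simp only [Finset.mem_range, Finset.mem_insert, Finset.mem_singleton] at ha ⊢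
      omega
    have h := hind.indepFun_finset _ _ hdisj hV
    let F : (Finset.range (2 * n) → E) → ℝ := fun v =>
      ∑ k : Fin n, g (v ⟨2 * k, by simp⟩, v ⟨2 * k + 1, by simp; omega⟩)
    let G : (({2 * n, 2 * n + 1} : Finset ℕ) → E) → ℝ := fun v =>
      g (v ⟨2 * n, by simp⟩, v ⟨2 * n + 1, by simp⟩)
    have hF : Measurable F :=
      Finset.measurable_sum _ fun k _ =>
        hg.comp ((measurable_pi_apply _).prodMk (measurable_pi_apply _))
    have hG : Measurable G := hg.comp ((measurable_pi_apply _).prodMk (measurable_pi_apply _))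
    have h' := h.comp hF hG
    have e1 : (F ∘ fun (a : Ω) (i : Finset.range (2 * n)) => V i a) =
        ∑ k ∈ Finset.range n, fun ω => g (V (2 * k) ω, V (2 * k + 1) ω) := by
      funext ω
      simp only [F, Function.comp, Finset.sum_apply]
      rw [Finset.sum_range]
    rw [e1] at h'
    refine h'.mgf_add ?_ ?_
    · have : Measurable (∑ k ∈ Finset.range n, fun ω => g (V (2 * k) ω, V (2 * k + 1) ω)) := by
        rw [← e1]
        exact hF.comp (measurable_pi_lambda _ fun i => hV i)
      exact (this.const_mul t).exp.aestronglyMeasurable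
    · exact ((hX n).const_mul t).exp.aestronglyMeasurable

theorem mgf_indicator_one [IsProbabilityMeasure P] {A : Set Ω} (hA : MeasurableSet A) (t : ℝ) :
    mgf (A.indicator fun _ => (1 : ℝ)) P t = 1 - P.real A * (1 - Real.exp t) := by
  have : (fun ω => Real.exp (t * A.indicator (fun _ => (1 : ℝ)) ω)) =
      fun ω => 1 + A.indicator (fun _ => Real.exp t - 1) ω := by
    funext ω
    by_cases h : ω ∈ A <;> simp [h]
  rw [mgf, this, integral_add (integrable_const _) ((integrable_const _).indicator hA),
    integral_indicator_const _ hA]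
  simp
  ring

open Classical in
/-- A multiplicative lower-tail Chernoff bound for the number of disjoint consecutive pairs of an
independent sequence that fall into a given set, all with the same probability `p`. -/
theorem measure_count_pairs_lt_le {V : ℕ → Ω → E} (hV : ∀ t, Measurable (V t))
    (hind : iIndepFun V P) {T : Set (E × E)} (hT : MeasurableSet T) {p c : ℝ}
    (hp : ∀ k, P.real {ω | (V (2 * k) ω, V (2 * k + 1) ω) ∈ T} = p) (n : ℕ) :
    P.real {ω | (((Finset.range n).filter
      fun k => (V (2 * k) ω, V (2 * k + 1) ω) ∈ T).card : ℝ) ≤ c} ≤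
      Real.exp (Real.log 2 * c - n * (p / 2)) := by
  have hP := hind.isProbabilityMeasure
  set g : E × E → ℝ := T.indicator fun _ => 1
  have hg : Measurable g := measurable_const.indicator hT
  have hcount : ∀ ω, (((Finset.range n).filter
      fun k => (V (2 * k) ω, V (2 * k + 1) ω) ∈ T).card : ℝ) =
      (∑ k ∈ Finset.range n, fun ω => g (V (2 * k) ω, V (2 * k + 1) ω)) ω := by
    intro ω
    simp [g, Finset.sum_apply, Set.indicator_apply, Finset.sum_boole]
  simp_rw [hcount]
  have hmeas : Measurable (∑ k ∈ Finset.range n, fun ω => g (V (2 * k) ω, V (2 * k + 1) ω)) :=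
    Finset.sum_induction _ _ (fun _ _ => Measurable.add) measurable_zero
      fun k _ => hg.comp ((hV _).prodMk (hV _))
  have hlog : 0 < Real.log 2 := Real.log_pos (by norm_num)
  have hint : Integrable (fun ω => Real.exp (-Real.log 2 *
      (∑ k ∈ Finset.range n, fun ω => g (V (2 * k) ω, V (2 * k + 1) ω)) ω)) P := by
    refine Integrable.of_bound (hmeas.const_mul _).exp.aestronglyMeasurable 1
      (Filter.Eventually.of_forall fun ω => ?_)
    rw [Real.norm_eq_abs, abs_of_pos (Real.exp_pos _), Real.exp_le_one_iff, ← hcount]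
    have : (0 : ℝ) ≤ ((Finset.range n).filter
      fun k => (V (2 * k) ω, V (2 * k + 1) ω) ∈ T).card := by positivity
    nlinarith
  -- At the parameter `-log 2` the exponential of an indicator drops to `1/2`, so each pair
  -- contributes the factor `1 - p / 2 ≤ exp (-(p / 2))`.
  refine (measure_le_le_exp_mul_mgf c (by linarith) hint).trans ?_
  rw [mgf_sum_consecutive_pairs hV hind hg, neg_neg]
  have hk : ∀ k ∈ Finset.range n,
      mgf (fun ω => g (V (2 * k) ω, V (2 * k + 1) ω)) P (-Real.log 2) = 1 - p / 2 := by
    intro k _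
    have hA : MeasurableSet {ω | (V (2 * k) ω, V (2 * k + 1) ω) ∈ T} :=
      ((hV _).prodMk (hV _)) hT
    have := mgf_indicator_one (P := P) hA (-Real.log 2)
    rw [hp k, Real.exp_neg, Real.exp_log (by norm_num)] at this
    rw [show 1 - p / 2 = 1 - p * (1 - 2⁻¹) by ring, ← this]
    rfl
  rw [Finset.prod_congr rfl hk, Finset.prod_const, Finset.card_range, sub_eq_add_neg (Real.log 2 * c),
    Real.exp_add]
  have h0 : 0 ≤ 1 - p / 2 := by
    have : p ≤ 1 := hp 0 ▸ measureReal_le_one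
    linarith
  gcongr
  calc (1 - p / 2) ^ n ≤ (Real.exp (-(p / 2))) ^ n := by
        gcongr
        have := Real.add_one_le_exp (-(p / 2))
        linarith
    _ = Real.exp (-(n * (p / 2))) := by rw [← Real.exp_nat_mul]; ring_nf

end Probability

/-! ### Counting decision lists. -/

section DecisionLists

variable {X : Type u} {Y : Type v}

/-- If a list is sorted by `r`, then the first element that satisfies `p` precedes all others. -/
theorem rel_of_find?_eq_some {α : Type*} {r : α → α → Prop} (hr : ∀ a, r a a) {l : List α}
    (hl : l.Pairwise r) {p : α → Bool} {a b : α} (ha : l.find? p = some a) (hb : b ∈ l)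
    (hpb : p b = true) : r a b := by
  rw [List.find?_eq_some_iff_append] at ha
  obtain ⟨_, as, bs, rfl, has⟩ := ha
  rw [List.pairwise_append, List.pairwise_cons] at hl
  rcases List.mem_append.1 hb with h | h
  · have := has b h
    simp [hpb] at this
  · rcases List.mem_cons.1 h with rfl | h
    · exact hr _
    · exact hl.2.1.1 b h

theorem DecisionList.eval_append_of_eq_some {L : DecisionList X Y} (L' : DecisionList X Y) {x : X}
    {y : Y} (h : L.eval x = some y) : DecisionList.eval (L ++ L') x = some y := by
  unfold DecisionList.eval at h ⊢
  rw [Option.map_eq_some_iff] at h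
  obtain ⟨r, hr, rfl⟩ := h
  rw [List.find?_append, hr]
  rfl

/-- Rules of a decision list, with conjunctions padded to `k` conjuncts by `none`. -/
def ruleOfCode {F : Set (X → Bool)} {k : ℕ} (c : (Fin k → Option F) × Y) : List (X → Bool) × Y :=
  (((List.ofFn c.1).reduceOption).map Subtype.val, c.2)

theorem exists_ruleOfCode_eq {F : Set (X → Bool)} {k : ℕ} (r : List (X → Bool) × Y)
    (hr : r.1.length ≤ k) (hF : ∀ φ ∈ r.1, φ ∈ F) :
    ∃ c : (Fin k → Option F) × Y, ruleOfCode c = r := by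
  obtain ⟨l, y⟩ := r
  simp only at hr hF
  lift l to List F using hF
  rw [List.length_map] at hr
  refine ⟨(fun i => l[(i : ℕ)]?, y), ?_⟩
  simp only [ruleOfCode, Prod.mk.injEq, and_true]
  congr 1
  have : List.ofFn (fun i : Fin k => l[(i : ℕ)]?) =
      l.map some ++ List.replicate (k - l.length) none := by
    apply List.ext_getElem?
    intro i
    rw [List.getElem?_append]
    simp only [List.getElem?_ofFn, List.length_map, List.getElem?_map, List.getElem?_replicate]
    split_ifs with h1 h2 h2 h3 <;> first | omega | simp_all
  rw [this, List.reduceOption_append]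
  simp [List.reduceOption, List.filterMap_map]

/-- Every concept of the decision list class comes from a list of exactly `m` padded rules. -/
theorem exists_code_of_mem_decisionListClass [Nonempty X] {m : ℕ} {F : Set (X → Bool)}
    {h : X → Y} (hh : h ∈ decisionListClass X Y m F) :
    ∃ c : Fin m → (Fin (m - 1) → Option F) × Y,
      ∀ x, DecisionList.eval (List.ofFn fun i => ruleOfCode (c i)) x = some (h x) := by
  obtain ⟨L, hL, hr, hx⟩ := hh
  have hne : L ≠ [] := by
    rintro rfl
    have := hx (Classical.arbitrary X)
    simp [DecisionList.eval] at this
  set r₀ := L.head hne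
  have hr₀ : r₀ ∈ L := List.head_mem hne
  have hget : ∀ i : Fin m, L.getD i r₀ ∈ L := by
    intro i
    by_cases hi : (i : ℕ) < L.length
    · rw [List.getD_eq_getElem _ _ hi]; exact List.getElem_mem _
    · rw [List.getD_eq_default _ _ (not_lt.1 hi)]; exact hr₀
  choose c hc using fun i : Fin m =>
    exists_ruleOfCode_eq (L.getD i r₀) (hr _ (hget i)).1 (hr _ (hget i)).2
  refine ⟨c, fun x => ?_⟩
  -- Rules appended to `L` are never reached, since `L` already decides every example; so any rule
  -- may serve as padding. One exists because `X` is nonempty.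
  have : (List.ofFn fun i => ruleOfCode (c i)) = L ++ List.replicate (m - L.length) r₀ := by
    simp_rw [hc]
    apply List.ext_getElem?
    intro i
    rw [List.getElem?_append]
    simp only [List.getElem?_ofFn, List.getElem?_replicate]
    split_ifs with h1 h2 h2 h3 <;> first | omega | simp_all
  rw [this]
  exact DecisionList.eval_append_of_eq_some _ (hx x)

/-- A code determines its concept, so the codes bound the class: each of the `m` rules has `m - 1`
slots, each holding a feature or `none`, and one label. -/
theorem finite_decisionListClass_and_ncard_le [Nonempty X] [Fintype Y] (m : ℕ)
    {F : Set (X → Bool)} (hF : F.Finite) :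
    (decisionListClass X Y m F).Finite ∧
      (decisionListClass X Y m F).ncard ≤ ((F.ncard + 1) ^ (m - 1) * Fintype.card Y) ^ m := by
  classical
  have := hF.fintype
  choose c hc using fun h : decisionListClass X Y m F => exists_code_of_mem_decisionListClass h.2
  have hinj : Function.Injective c := by
    intro h h' he
    ext x
    have h1 := hc h x
    rw [he, hc h' x] at h1
    exact (Option.some.inj h1).symm
  refine ⟨Set.finite_coe_iff.1 (Finite.of_injective c hinj), ?_⟩
  rw [← Nat.card_coe_set_eq]
  refine (Nat.card_le_card_of_injective c hinj).trans ?_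
  rw [Nat.card_eq_fintype_card, Set.ncard_eq_toFinset_card']
  simp

theorem logb_ncard_decisionListClass_le [Nonempty X] [Fintype Y] (m : ℕ) {F : Set (X → Bool)}
    (hF : F.Finite) {K : ℝ} (hK : (F.ncard : ℝ) + 1 ≤ K) :
    Real.logb 2 ((decisionListClass X Y m F).ncard : ℝ) ≤
      (m : ℝ) * Real.logb 2 (max m (Fintype.card Y) : ℕ) + (m : ℝ) ^ 2 * Real.logb 2 K := by
  have hK1 : 1 ≤ K := le_trans (by simp) hK
  have h1 : 0 ≤ Real.logb 2 (max m (Fintype.card Y) : ℕ) :=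
    div_nonneg (Real.log_natCast_nonneg _) (Real.log_nonneg (by norm_num))
  have h2 : 0 ≤ Real.logb 2 K := Real.logb_nonneg (by norm_num) hK1
  -- The class may be empty; then `Real.logb 2 0 = 0` and the bound is trivial.
  rcases Nat.eq_zero_or_pos (decisionListClass X Y m F).ncard with h0 | hpos
  · rw [h0]
    simp only [Nat.cast_zero, Real.logb_zero]
    positivity
  have hle := (finite_decisionListClass_and_ncard_le (Y := Y) m hF).2
  rcases Nat.eq_zero_or_pos m with rfl | hm
  · have : (decisionListClass X Y 0 F).ncard = 1 := by
      have : (decisionListClass X Y 0 F).ncard ≤ 1 := by simpa using hle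
      omega
    simp [this]
  have hM : 0 < max m (Fintype.card Y) := lt_max_of_lt_left hm
  have hle' : ((decisionListClass X Y m F).ncard : ℝ) ≤
      ((max m (Fintype.card Y) : ℕ) : ℝ) ^ m * K ^ (m ^ 2) := by
    calc ((decisionListClass X Y m F).ncard : ℝ)
        ≤ (((F.ncard + 1) ^ (m - 1) * Fintype.card Y) ^ m : ℕ) := by exact_mod_cast hle
      _ = (Fintype.card Y : ℝ) ^ m * ((F.ncard : ℝ) + 1) ^ ((m - 1) * m) := by
          push_cast
          rw [mul_pow, ← pow_mul, mul_comm]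
      _ ≤ _ := by
          gcongr ?_ ^ m * ?_
          · exact_mod_cast le_max_right _ _
          · calc ((F.ncard : ℝ) + 1) ^ ((m - 1) * m) ≤ K ^ ((m - 1) * m) := by gcongr
              _ ≤ K ^ (m ^ 2) := by
                  apply pow_le_pow_right₀ hK1
                  rw [sq]
                  exact Nat.mul_le_mul_right _ (Nat.sub_le _ _)
  calc _ ≤ Real.logb 2 (((max m (Fintype.card Y) : ℕ) : ℝ) ^ m * K ^ (m ^ 2)) :=
        Real.logb_le_logb_of_le (by norm_num) (by exact_mod_cast hpos) hle'
    _ = _ := by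
        rw [Real.logb_mul (by positivity) (by positivity), Real.logb_pow, Real.logb_pow]
        push_cast
        ring

end DecisionLists

/-! ### The protocol and its frequent features. -/

section Protocol

variable {X : Type u} {Y : Type v}

theorem Feature.neg_neg (φ : X → Bool) : Feature.neg (Feature.neg φ) = φ := by
  funext x
  simp [Feature.neg]

open Classical in
/-- The number of times `k < n` at which `o k` is the feature `f` or its negation. -/
noncomputable def featureCount (o : ℕ → Option (X → Bool)) (n : ℕ) (f : X → Bool) : ℕ :=
  ((Finset.range n).filter fun k => o k = some f ∨ o k = some (Feature.neg f)).card

/-- The features that, up to negation, occur at least once and at least `θ` times before `n`. -/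
def frequentFeatures (o : ℕ → Option (X → Bool)) (n : ℕ) (θ : ℝ) : Set (X → Bool) :=
  {f | 0 < featureCount o n f ∧ θ ≤ featureCount o n f}

theorem featureCount_neg (o : ℕ → Option (X → Bool)) (n : ℕ) (f : X → Bool) :
    featureCount o n (Feature.neg f) = featureCount o n f := by
  classical
  unfold featureCount
  congr 1
  ext k
  rw [Finset.mem_filter, Finset.mem_filter, Feature.neg_neg, or_comm (a := o k = some f)]

theorem exists_of_mem_frequentFeatures {o : ℕ → Option (X → Bool)} {n : ℕ} {θ : ℝ}
    {f : X → Bool} (hf : f ∈ frequentFeatures o n θ) :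
    ∃ k < n, o k = some f ∨ o k = some (Feature.neg f) := by
  classical
  obtain ⟨k, hk⟩ := Finset.card_pos.1 hf.1
  rw [Finset.mem_filter, Finset.mem_range] at hk
  exact ⟨k, hk⟩

theorem finite_frequentFeatures (o : ℕ → Option (X → Bool)) (n : ℕ) (θ : ℝ) :
    (frequentFeatures o n θ).Finite := by
  refine Set.Finite.subset (s := ⋃ k ∈ Finset.range n,
    {f | o k = some f ∨ o k = some (Feature.neg f)}) ?_ ?_
  · refine Set.Finite.biUnion (Finset.finite_toSet _) fun k _ => ?_
    cases h : o k with
    | none => simp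
    | some g =>
      refine Set.Finite.subset (Set.toFinite {g, Feature.neg g}) ?_
      rintro f (hf | hf)
      · left; exact (Option.some.inj hf).symm
      · right
        rw [Set.mem_singleton_iff, Option.some.inj hf, Feature.neg_neg]
  · intro f hf
    obtain ⟨k, hk, h⟩ := exists_of_mem_frequentFeatures hf
    simp only [Set.mem_iUnion]
    exact ⟨k, Finset.mem_range.2 hk, h⟩

/-- Double counting: one observation counts for at most two features, itself and its negation, so
the counts sum to at most `2 * n`. -/
theorem ncard_frequentFeatures_le (o : ℕ → Option (X → Bool)) (n : ℕ) {β : ℝ} (hβ : 0 < β) :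
    ((frequentFeatures o n (β * n)).ncard : ℝ) ≤ 2 / β := by
  classical
  have hfin := finite_frequentFeatures o n (β * n)
  set T := hfin.toFinset
  rw [Set.ncard_eq_toFinset_card _ hfin]
  have h1 : ∑ f ∈ T, featureCount o n f ≤ 2 * n := by
    simp only [featureCount, Finset.card_filter]
    rw [Finset.sum_comm]
    calc _ ≤ ∑ k ∈ Finset.range n, 2 := Finset.sum_le_sum fun k _ => ?_
      _ = 2 * n := by simp [mul_comm]
    rw [← Finset.card_filter]
    cases h : o k with
    | none => simp
    | some g =>
      refine (Finset.card_le_card (t := {g, Feature.neg g}) ?_).trans Finset.card_le_two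
      intro f hf
      rw [Finset.mem_insert, Finset.mem_singleton]
      rcases (Finset.mem_filter.1 hf).2 with hf | hf
      · left; exact (Option.some.inj hf).symm
      · right; rw [Option.some.inj hf, Feature.neg_neg]
  have h2 : (T.card : ℝ) * (β * n) ≤ 2 * n := by
    calc (T.card : ℝ) * (β * n) = ∑ f ∈ T, β * n := by simp
      _ ≤ ∑ f ∈ T, (featureCount o n f : ℝ) :=
          Finset.sum_le_sum fun f hf => (hfin.mem_toFinset.1 hf).2
      _ ≤ 2 * n := by exact_mod_cast h1
  -- For `n = 0` the threshold is zero; the requirement of a positive count is what excludes all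
  -- features.
  rcases Nat.eq_zero_or_pos n with rfl | hn
  · have : T = ∅ := by
      rw [Finset.eq_empty_iff_forall_notMem]
      intro f hf
      obtain ⟨k, hk, -⟩ := exists_of_mem_frequentFeatures (hfin.mem_toFinset.1 hf)
      omega
    change (T.card : ℝ) ≤ _
    rw [this]
    simp only [Finset.card_empty, Nat.cast_zero]
    positivity
  · have hn' : (0 : ℝ) < n := by exact_mod_cast hn
    rw [le_div_iff₀ hβ]
    nlinarith

/-- The protocol that runs for `2 * N` rounds, always explains an instance by the preceding one,
and outputs the features that were given in a fraction of at least `β` of the odd rounds. -/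
noncomputable def consecutivePairsProtocol (X : Type u) (Y : Type v) (N : ℕ) (β : ℝ) :
    FeatureDiscoveryProtocol X Y where
  halts h := 2 * N ≤ h.length
  output h := frequentFeatures (fun k => h[2 * k + 1]?.bind Round.feature) N (β * N)
  explain h hne _ := ⟨h.length - 1, Nat.sub_lt (List.length_pos_iff.2 hne) one_pos⟩

variable [MeasurableSpace X] [MeasurableSpace Y] {Φ : Set (X → Bool)} {m : ℕ}
  {R : ComponentRepresentation Y Φ m} {ε : ℝ} {Ω : Type w} [MeasurableSpace Ω] {P : Measure Ω}

theorem FeatureDiscoveryProtocol.length_history (A : FeatureDiscoveryProtocol X Y)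
    (S : DFFStream R ε P) (ω : Ω) (n : ℕ) : (A.history S ω n).length = n := by
  induction n with
  | zero => rfl
  | succ n ih => simp [FeatureDiscoveryProtocol.history, ih]

/-- The first round involves no prediction, which saves one mistake. -/
theorem FeatureDiscoveryProtocol.mistakes_history_le (A : FeatureDiscoveryProtocol X Y)
    (S : DFFStream R ε P) (ω : Ω) (n : ℕ) : mistakes (A.history S ω n) ≤ n - 1 := by
  induction n with
  | zero => simp [FeatureDiscoveryProtocol.history, mistakes]
  | succ n ih =>
    rcases Nat.eq_zero_or_pos n with rfl | hn
    · simp [FeatureDiscoveryProtocol.history, mistakes]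
    · unfold mistakes at ih ⊢
      rw [FeatureDiscoveryProtocol.history, List.countP_append]
      have := List.countP_le_length (p := fun r : Round X Y => r.feature.isSome) (l :=
        [{ x := S.x n ω
           y := S.y n ω
           feature :=
              open Classical in
              if hne : A.history S ω n ≠ [] then
                let s := A.explain (A.history S ω n) hne (S.x n ω)
                if ((A.history S ω n).get s).y = S.y n ω then none else some (S.feedback n s ω)
              else none }])
      rw [List.length_singleton] at this
      refine (Nat.add_le_add ih this).trans ?_
      omega

theorem FeatureDiscoveryProtocol.y_getElem_history (A : FeatureDiscoveryProtocol X Y)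
    (S : DFFStream R ε P) (ω : Ω) (n k : ℕ) (hk : k < (A.history S ω n).length) :
    (A.history S ω n)[k].y = S.y k ω := by
  induction n with
  | zero => simp [FeatureDiscoveryProtocol.history] at hk
  | succ n ih =>
    simp only [FeatureDiscoveryProtocol.history]
    rw [List.getElem_append]
    by_cases h : k < (A.history S ω n).length
    · rw [dif_pos h]
      exact ih h
    · rw [dif_neg h]
      have hk' := hk
      rw [A.length_history] at hk' h
      obtain rfl : k = n := by omega
      simp

open Classical in
theorem feature_history_consecutivePairsProtocol (S : DFFStream R ε P) (ω : Ω) (N : ℕ) (β : ℝ)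
    (n k : ℕ) (hk : k + 1 < n) :
    ((consecutivePairsProtocol X Y N β).history S ω n)[k + 1]?.bind Round.feature =
      if S.y k ω = S.y (k + 1) ω then none else some (S.feedback (k + 1) k ω) := by
  set A := consecutivePairsProtocol X Y N β with hA
  induction n with
  | zero => omega
  | succ n ih =>
    simp only [FeatureDiscoveryProtocol.history]
    rw [List.getElem?_append]
    by_cases h : k + 1 < n
    · rw [if_pos (by rwa [A.length_history]), ih h]
    · rw [if_neg (by rwa [A.length_history])]
      obtain rfl : n = k + 1 := by omega
      have hne : A.history S ω (k + 1) ≠ [] := by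
        rw [← List.length_pos_iff, A.length_history]; omega
      have hs : ((A.explain (A.history S ω (k + 1)) hne (S.x (k + 1) ω) :
          Fin (A.history S ω (k + 1)).length) : ℕ) = k := by
        simp [hA, consecutivePairsProtocol, FeatureDiscoveryProtocol.length_history]
      simp [hne, A.length_history, A.y_getElem_history, hs]

end Protocol

/-! ### A decision list built from the heavy pairs. -/

section Representation

variable {X : Type u} {Y : Type v} [MeasurableSpace X]
  {Φ : Set (X → Bool)} {m : ℕ}

/-- The components that, with component weights `q`, may be misclassified by the rule of another
component if only the features for pairs of components with `β ≤ q i * q j` are available. -/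
def ComponentRepresentation.lightComponents (R : ComponentRepresentation Y Φ m) (q : Fin m → ℝ)
    (β : ℝ) : Set (Fin m) :=
  {i | ∃ j, R.label i ≠ R.label j ∧ q i ≤ q j ∧ q i * q j < β}

/-- The rules are ordered by decreasing weight. If the first satisfied rule belongs to `w` and has a
wrong label, then `w` weighs at least as much as the instance's own component `i`. Moreover `q w * q
i < β`, since otherwise that rule would contain `disc w i`, which is false on component `i`. -/
theorem ComponentRepresentation.exists_mem_decisionListClass (R : ComponentRepresentation Y Φ m)
    (q : Fin m → ℝ) (β : ℝ) {F : Set (X → Bool)}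
    (hF : ∀ i j, R.label i ≠ R.label j → β ≤ q i * q j → R.disc i j ∈ F) :
    ∃ h ∈ decisionListClass X Y m F,
      ∀ x, R.idx x ∉ R.lightComponents q β → h x = R.concept x := by
  classical
  let l : List (Fin m) := (List.finRange m).insertionSort fun i j => q j ≤ q i
  have hsort : l.Pairwise fun i j => q j ≤ q i := by
    have : Std.Total fun i j : Fin m => q j ≤ q i := ⟨fun i j => le_total _ _⟩
    have : IsTrans (Fin m) fun i j => q j ≤ q i := ⟨fun _ _ _ h1 h2 => h2.trans h1⟩
    exact List.pairwise_insertionSort _ _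
  have hmem : ∀ i, i ∈ l := fun i => (List.mem_insertionSort _).2 (List.mem_finRange i)
  have hlen : l.length = m := by simp [l, List.length_insertionSort]
  let rule : Fin m → List (X → Bool) × Y := fun i =>
    (((Finset.univ.filter fun j => R.label i ≠ R.label j ∧ β ≤ q i * q j).toList).map (R.disc i),
      R.label i)
  have hrule : ∀ x, ((rule (R.idx x)).1.all fun φ => φ x) = true := by
    intro x
    simp only [rule, List.all_map, List.all_eq_true, Finset.mem_toList, Finset.mem_filter,
      Function.comp]
    exact fun j hj => R.disc_of_mem_left _ _ hj.2.1 x (R.mem_comp_idx x)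
  have hfind : ∀ x, ∃ i, l.find? (fun i => (rule i).1.all fun φ => φ x) = some i := by
    intro x
    rw [← Option.isSome_iff_exists, List.find?_isSome]
    exact ⟨R.idx x, hmem _, hrule x⟩
  choose w hw using hfind
  refine ⟨fun x => R.label (w x), ⟨l.map rule, by simp [hlen], ?_, fun x => ?_⟩, fun x hx => ?_⟩
  · intro r hr
    obtain ⟨i, -, rfl⟩ := List.mem_map.1 hr
    constructor
    · simp only [rule, List.length_map, Finset.length_toList]
      calc _ ≤ (Finset.univ.erase i).card := Finset.card_le_card fun j hj => by
            rw [Finset.mem_filter] at hj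
            rw [Finset.mem_erase]
            exact ⟨fun h => hj.2.1 (by rw [h]), Finset.mem_univ _⟩
        _ = m - 1 := by simp
    · intro φ hφ
      obtain ⟨j, hj, rfl⟩ := List.mem_map.1 hφ
      rw [Finset.mem_toList, Finset.mem_filter] at hj
      exact hF i j hj.2.1 hj.2.2
  · unfold DecisionList.eval
    rw [List.find?_map]
    have := hw x
    simp only [Function.comp_def]
    rw [this]
    rfl
  · by_contra hne
    have hle := rel_of_find?_eq_some (r := fun i j => q j ≤ q i) (fun _ => le_rfl) hsort (hw x) (hmem _) (hrule x)
    refine hx ⟨w x, fun h => hne h.symm, hle, ?_⟩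
    by_contra hβ
    have h1 := List.find?_some (hw x)
    simp only [rule, List.all_map, List.all_eq_true, Finset.mem_toList, Finset.mem_filter,
      Function.comp] at h1
    have h2 := h1 (R.idx x) ⟨Finset.mem_univ _, hne, by rw [mul_comm]; exact not_lt.1 hβ⟩
    rw [R.disc_of_mem_right _ _ hne x (R.mem_comp_idx x)] at h2
    exact absurd h2 (by simp)

theorem ComponentRepresentation.sum_lightComponents_le (R : ComponentRepresentation Y Φ m)
    {q : Fin m → ℝ} (hq : ∀ i, 0 ≤ q i) {β : ℝ} (s : Finset (Fin m))
    (hs : ∀ i ∈ s, i ∈ R.lightComponents q β) :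
    ∑ i ∈ s, q i ≤ Real.sqrt β * (m : ℝ) ^ 2 / 2 := by
  have hsq : ∀ i ∈ s, q i ≤ Real.sqrt β := by
    intro i hi
    obtain ⟨j, -, hle, hlt⟩ := hs i hi
    apply Real.le_sqrt_of_sq_le
    nlinarith [hq i]
  rcases s.eq_empty_or_nonempty with rfl | ⟨i, hi⟩
  · simp; positivity
  -- A light component has a partner with a different label, and `m ≥ 2` turns the natural bound `m
  -- * √β` into `√β * m ^ 2 / 2`.
  have hm : 2 ≤ m := by
    obtain ⟨j, hne, -⟩ := hs i hi
    have hij : (i : ℕ) ≠ j := fun h => hne (by rw [Fin.ext h])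
    omega
  have hm' : (2 : ℝ) ≤ m := by exact_mod_cast hm
  calc ∑ i ∈ s, q i ≤ s.card • Real.sqrt β := Finset.sum_le_card_nsmul _ _ _ hsq
    _ = s.card * Real.sqrt β := by simp
    _ ≤ m * Real.sqrt β := by
        gcongr
        exact_mod_cast (Finset.card_le_univ s).trans (by simp)
    _ ≤ _ := by nlinarith [Real.sqrt_nonneg β, mul_nonneg (Real.sqrt_nonneg β) (by linarith : (0:ℝ) ≤ m)]

end Representation

/-! ### Detecting heavy pairs and bounding the error. -/

section Stream

variable {X : Type u} {Y : Type v} [MeasurableSpace X] [MeasurableSpace Y] {Φ : Set (X → Bool)}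
  {m : ℕ} {R : ComponentRepresentation Y Φ m} {ε : ℝ} {Ω : Type w} [MeasurableSpace Ω]
  {P : Measure Ω}

/-- The outcomes of a round without exception whose instance is assigned to the component `i`. -/
def ComponentRepresentation.regular (R : ComponentRepresentation Y Φ m) (i : Fin m) :
    Set (X × Y × Prop) :=
  {p | ¬ p.2.2 ∧ R.idx p.1 = i}

/-- The outcomes of two rounds without exception, one instance being assigned to `i` and the other
one to `j`. -/
def ComponentRepresentation.regularPair (R : ComponentRepresentation Y Φ m) (i j : Fin m) :
    Set ((X × Y × Prop) × X × Y × Prop) :=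
  R.regular i ×ˢ R.regular j ∪ R.regular j ×ˢ R.regular i

theorem ComponentRepresentation.measurableSet_regular (R : ComponentRepresentation Y Φ m)
    (i : Fin m) : MeasurableSet (R.regular i) := by
  refine MeasurableSet.inter ?_ ?_
  · exact (measurableSet_setOfPred.2 (measurable_snd.comp measurable_snd)).compl
  · exact (R.measurable_idx.comp measurable_fst) (measurableSet_singleton i)

theorem ComponentRepresentation.measurableSet_regularPair (R : ComponentRepresentation Y Φ m)
    (i j : Fin m) : MeasurableSet (R.regularPair i j) :=
  ((R.measurableSet_regular i).prod (R.measurableSet_regular j)).union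
    ((R.measurableSet_regular j).prod (R.measurableSet_regular i))

namespace DFFStream

/-- All that happens at time `t`. -/
def triple (S : DFFStream R ε P) (t : ℕ) (ω : Ω) : X × Y × Prop := (S.x t ω, S.y t ω, S.exc t ω)

theorem measurable_triple (S : DFFStream R ε P) (t : ℕ) : Measurable (S.triple t) :=
  (S.measurable_x t).prodMk ((S.measurable_y t).prodMk (S.measurable_exc t))

/-- The probability of a round without exception with an instance assigned to `i`. -/
noncomputable def weight (S : DFFStream R ε P) (i : Fin m) : ℝ :=
  P.real (S.triple 0 ⁻¹' R.regular i)

theorem weight_nonneg (S : DFFStream R ε P) (i : Fin m) : 0 ≤ S.weight i := measureReal_nonneg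

theorem measureReal_preimage_regular (S : DFFStream R ε P) (t : ℕ) (i : Fin m) :
    P.real (S.triple t ⁻¹' R.regular i) = S.weight i :=
  congrArg ENNReal.toReal ((S.identDistrib t).measure_mem_eq (R.measurableSet_regular i))

theorem sum_weight_le_one [IsProbabilityMeasure P] (S : DFFStream R ε P) :
    ∑ i, S.weight i ≤ 1 := by
  unfold weight
  rw [← measureReal_biUnion_finset]
  · exact measureReal_le_one
  · intro i _ j _ hij
    refine Set.disjoint_left.2 fun ω hi hj => hij ?_
    exact hi.2.symm.trans hj.2
  · exact fun i _ => S.measurable_triple 0 (R.measurableSet_regular i)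

theorem measureReal_regularPair [IsProbabilityMeasure P] (S : DFFStream R ε P) {s t : ℕ}
    (hst : s ≠ t) {i j : Fin m} (hij : i ≠ j) :
    P.real {ω | (S.triple s ω, S.triple t ω) ∈ R.regularPair i j} =
      2 * (S.weight i * S.weight j) := by
  have hprod : ∀ i j, P.real (S.triple s ⁻¹' R.regular i ∩ S.triple t ⁻¹' R.regular j) =
      S.weight i * S.weight j := by
    intro i j
    have h := (S.indep.indepFun hst).measure_inter_preimage_eq_mul _ _
      (R.measurableSet_regular i) (R.measurableSet_regular j)
    rw [← S.measureReal_preimage_regular s i, ← S.measureReal_preimage_regular t j]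
    simp only [Measure.real, ← ENNReal.toReal_mul]
    exact congrArg ENNReal.toReal h
  have : {ω | (S.triple s ω, S.triple t ω) ∈ R.regularPair i j} =
      (S.triple s ⁻¹' R.regular i ∩ S.triple t ⁻¹' R.regular j) ∪
      (S.triple s ⁻¹' R.regular j ∩ S.triple t ⁻¹' R.regular i) := rfl
  rw [this, measureReal_union, hprod, hprod]
  · ring
  · refine Set.disjoint_left.2 fun ω hi hj => hij ?_
    exact hi.1.2.symm.trans hj.1.2
  · exact (S.measurable_triple s (R.measurableSet_regular j)).inter
      (S.measurable_triple t (R.measurableSet_regular i))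

open Classical in
/-- The event that among the first `N` disjoint pairs of consecutive rounds at most `c` show the
components `i` and `j` without exception. -/
def rarePair (S : DFFStream R ε P) (N : ℕ) (c : ℝ) (i j : Fin m) : Set Ω :=
  {ω | (((Finset.range N).filter fun k =>
    (S.triple (2 * k) ω, S.triple (2 * k + 1) ω) ∈ R.regularPair i j).card : ℝ) ≤ c}

/-- The factor 2 from the two orders of the pair cancels the `1/2` in the Chernoff exponent. -/
theorem measureReal_rarePair_le [IsProbabilityMeasure P] (S : DFFStream R ε P) (N : ℕ) (c : ℝ)
    {i j : Fin m} (hij : i ≠ j) :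
    P.real (S.rarePair N c i j) ≤
      Real.exp (Real.log 2 * c - N * (S.weight i * S.weight j)) := by
  have h := measure_count_pairs_lt_le S.measurable_triple S.indep
    (R.measurableSet_regularPair i j)
    (fun k => S.measureReal_regularPair (by omega : 2 * k ≠ 2 * k + 1) hij) (c := c) N
  rwa [mul_div_cancel_left₀ _ (two_ne_zero' ℝ)] at h

theorem disc_mem_output (S : DFFStream R ε P) {N : ℕ} {β : ℝ} (hβ : 0 ≤ β) {i j : Fin m}
    (hl : R.label i ≠ R.label j) {ω : Ω} (hω : ω ∉ S.rarePair N (β * N) i j) {n : ℕ}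
    (hn : 2 * N ≤ n) :
    R.disc i j ∈ (consecutivePairsProtocol X Y N β).output
      ((consecutivePairsProtocol X Y N β).history S ω n) := by
  classical
  set A := consecutivePairsProtocol X Y N β with hA
  set o : ℕ → Option (X → Bool) := fun k => (A.history S ω n)[2 * k + 1]?.bind Round.feature
    with ho
  change R.disc i j ∈ frequentFeatures o N (β * N)
  have hlt : β * N < ((Finset.range N).filter fun k =>
      (S.triple (2 * k) ω, S.triple (2 * k + 1) ω) ∈ R.regularPair i j).card := by
    rw [rarePair, Set.mem_ofPred_eq, not_le] at hω
    convert hω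
  have hsub : ((Finset.range N).filter fun k =>
      (S.triple (2 * k) ω, S.triple (2 * k + 1) ω) ∈ R.regularPair i j).card ≤
      featureCount o N (R.disc i j) := by
    unfold featureCount
    refine Finset.card_le_card fun k hk => ?_
    rw [Finset.mem_filter] at hk ⊢
    refine ⟨hk.1, ?_⟩
    have hkN := Finset.mem_range.1 hk.1
    -- The feature is true on the component of the later instance, so the order of the pair decides
    -- between `disc i j` and its negation; both are counted.
    have key : ∀ a b, R.label a ≠ R.label b → S.triple (2 * k) ω ∈ R.regular a →
        S.triple (2 * k + 1) ω ∈ R.regular b → o k = some (R.disc b a) := by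
      intro a b hab h0 h1
      have e0 : R.idx (S.x (2 * k) ω) = a := h0.2
      have e1 : R.idx (S.x (2 * k + 1) ω) = b := h1.2
      have y0 := S.label_eq _ _ h0.1
      have y1 := S.label_eq _ _ h1.1
      have hc : R.concept (S.x (2 * k + 1) ω) ≠ R.concept (S.x (2 * k) ω) := by
        unfold ComponentRepresentation.concept
        rw [e0, e1]
        exact hab.symm
      simp only [ho]
      rw [hA, feature_history_consecutivePairsProtocol S ω N β n (2 * k) (by omega),
        if_neg (by rw [y0, y1]; exact hc.symm), S.feedback_eq _ _ _ h1.1 h0.1 hc, e0, e1]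
    rcases hk.2 with h | h
    · right
      rw [key i j hl h.1 h.2, R.disc_neg i j hl]
    · left
      exact key j i hl.symm h.1 h.2
  have hlt' : β * N < featureCount o N (R.disc i j) := hlt.trans_le (by exact_mod_cast hsub)
  refine ⟨?_, hlt'.le⟩
  have : (0 : ℝ) < featureCount o N (R.disc i j) := lt_of_le_of_lt (by positivity) hlt'
  exact_mod_cast this

theorem output_subset (S : DFFStream R ε P) (hΦ : ∀ φ ∈ Φ, Feature.neg φ ∈ Φ) (N : ℕ) (β : ℝ)
    (ω : Ω) {n : ℕ} (hn : 2 * N ≤ n) :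
    (consecutivePairsProtocol X Y N β).output
      ((consecutivePairsProtocol X Y N β).history S ω n) ⊆ Φ := by
  classical
  intro f hf
  obtain ⟨k, hk, h⟩ := exists_of_mem_frequentFeatures hf
  rw [feature_history_consecutivePairsProtocol S ω N β n (2 * k) (by omega)] at h
  split_ifs at h with hy
  · simp at h
  · rcases h with h | h
    · rw [← Option.some.inj h]
      exact S.feedback_mem _ _ _
    · rw [← Feature.neg_neg f, ← Option.some.inj h]
      exact hΦ _ (S.feedback_mem _ _ _)

theorem classErr_decisionListClass_le [IsProbabilityMeasure P] [Countable Y]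
    [MeasurableSingletonClass Y] (S : DFFStream R ε P) (hε : 0 ≤ ε) {β : ℝ} {F : Set (X → Bool)}
    (hF : ∀ i j, R.label i ≠ R.label j → β ≤ S.weight i * S.weight j → R.disc i j ∈ F) :
    classErr (decisionListClass X Y m F) S.dist ≤
      ENNReal.ofReal (ε + Real.sqrt β * (m : ℝ) ^ 2 / 2) := by
  classical
  obtain ⟨h, hh, heq⟩ := R.exists_mem_decisionListClass S.weight β hF
  refine (iInf₂_le h hh).trans ?_
  set bad : Finset (Fin m) := Finset.univ.filter fun i => i ∈ R.lightComponents S.weight β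
  -- The error set of `h` is enlarged to a set defined by `idx` and the labels alone, whose
  -- measurability, needed for the pushforward, is evident.
  set M : Set (X × Y) := {p | R.concept p.1 = p.2 ∧ R.idx p.1 ∉ bad}ᶜ with hM
  have hMm : MeasurableSet M := by
    refine (MeasurableSet.inter ?_ ?_).compl
    · refine measurableSet_eq_fun ?_ measurable_snd
      exact (Measurable.of_discrete (f := R.label)).comp (R.measurable_idx.comp measurable_fst)
    · exact (R.measurable_idx.comp measurable_fst)
        (MeasurableSet.of_discrete (s := {i | i ∉ bad}))
  calc err h S.dist ≤ S.dist M := by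
        refine measure_mono fun p hp hc => hp ?_
        rw [heq p.1 (fun hb => hc.2 (by simpa [bad] using hb)), hc.1]
    _ = P ((fun ω => (S.x 0 ω, S.y 0 ω)) ⁻¹' M) :=
        Measure.map_apply ((S.measurable_x 0).prodMk (S.measurable_y 0)) hMm
    _ ≤ P ({ω | S.exc 0 ω} ∪ ⋃ i ∈ bad, S.triple 0 ⁻¹' R.regular i) := by
        refine measure_mono fun ω hω => ?_
        by_cases he : S.exc 0 ω
        · exact Or.inl he
        · right
          by_contra hc
          refine hω ⟨(S.label_eq 0 ω he).symm, fun hb => hc ?_⟩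
          exact Set.mem_biUnion (show R.idx (S.x 0 ω) ∈ (bad : Set (Fin m)) from hb) ⟨he, rfl⟩
    _ ≤ ENNReal.ofReal ε + ∑ i ∈ bad, ENNReal.ofReal (S.weight i) := by
        refine (measure_union_le _ _).trans (add_le_add S.exc_rate ?_)
        refine (measure_biUnion_finset_le _ _).trans (Finset.sum_le_sum fun i _ => ?_)
        rw [weight, ofReal_measureReal]
    _ = ENNReal.ofReal (ε + ∑ i ∈ bad, S.weight i) := by
        rw [ENNReal.ofReal_add hε (Finset.sum_nonneg fun i _ => S.weight_nonneg i),
          ENNReal.ofReal_sum_of_nonneg fun i _ => S.weight_nonneg i]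
    _ ≤ _ := by
        refine ENNReal.ofReal_le_ofReal (add_le_add le_rfl ?_)
        exact R.sum_lightComponents_le S.weight_nonneg bad fun i hi => (Finset.mem_filter.1 hi).2

end DFFStream

end Stream

/-! ### Failure probability and conclusion. -/

/-- The left side is the off-diagonal part of the expanded square. It lets the failure bounds of all
pairs sum to at most `δ`. -/
theorem sum_lt_two_mul_le_sq {ι : Type*} [Fintype ι] [LinearOrder ι] {q : ι → ℝ}
    (hq : ∀ i, 0 ≤ q i) :
    ∑ p : ι × ι with p.1 < p.2, 2 * (q p.1 * q p.2) ≤ (∑ i, q i) ^ 2 := by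
  have hswap : ∑ p : ι × ι with p.1 < p.2, q p.1 * q p.2 =
      ∑ p : ι × ι with p.2 < p.1, q p.1 * q p.2 :=
    Finset.sum_equiv (Equiv.prodComm ι ι) (by simp) (by simp [mul_comm])
  have hdisj : Disjoint (Finset.univ.filter fun p : ι × ι => p.1 < p.2)
      (Finset.univ.filter fun p : ι × ι => p.2 < p.1) :=
    Finset.disjoint_filter.2 fun p _ h => h.not_gt
  calc _ = ∑ p : ι × ι with p.1 < p.2, q p.1 * q p.2 +
        ∑ p : ι × ι with p.2 < p.1, q p.1 * q p.2 := by
        rw [← Finset.mul_sum, ← hswap, two_mul]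
    _ ≤ ∑ p : ι × ι, q p.1 * q p.2 := by
        rw [← Finset.sum_union hdisj]
        exact Finset.sum_le_sum_of_subset_of_nonneg (Finset.subset_univ _)
          fun p _ _ => mul_nonneg (hq _) (hq _)
    _ = _ := by rw [sq, Finset.sum_mul_sum, Fintype.sum_prod_type]

/-- The failure probability for one pair of components, if the number of tested pairs is about
half the mistake bound. -/
theorem exp_failure_le {β δ p : ℝ} {N : ℕ} (hβ0 : 0 < β) (hβ : β ≤ 1 / 4) (hδ0 : 0 < δ)
    (hδ1 : δ < 1) (hp : β ≤ p)
    (hN : 12 * Real.log (1 / (2 * δ * β)) / β ≤ 2 * N + 1) :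
    Real.exp (Real.log 2 * (β * N) - N * p) ≤ δ * (2 * p) := by
  set l := Real.log (1 / (2 * δ * β)) with hl
  have hlog2 := Real.log_two_lt_d9
  have hlog2' := Real.log_two_gt_d9
  have hδβ : 2 * δ * β ≤ 1 / 2 := by nlinarith
  have hl2 : Real.log 2 ≤ l := by
    apply Real.log_le_log (by norm_num)
    rw [le_div_iff₀ (by positivity)]
    linarith
  have hexp : Real.exp (-l) = 2 * δ * β := by
    rw [hl, one_div, Real.log_inv, neg_neg, Real.exp_log (by positivity)]
  rw [div_le_iff₀ hβ0] at hN
  have hNp : N * β ≤ N * p := by gcongr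
  -- Since `p ≥ β`, the exponent is at most `-(1 - log 2) * N * β`, and `N * β ≥ 6 * l - β / 2`. As
  -- `6 * (1 - log 2) > 1.8`, the surplus over `l` absorbs the rounding term, because `l ≥ log 2`
  -- and `β ≤ 1/4`.
  calc _ ≤ Real.exp (-l) := by
        apply Real.exp_le_exp.2
        nlinarith
    _ = 2 * δ * β := hexp
    _ ≤ δ * (2 * p) := by nlinarith

namespace DFFStream

variable {X : Type u} {Y : Type v} [MeasurableSpace X] [MeasurableSpace Y] {Φ : Set (X → Bool)}
  {m : ℕ} {R : ComponentRepresentation Y Φ m} {ε : ℝ} {Ω : Type w} [MeasurableSpace Ω]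
  {P : Measure Ω}

/-- Hence heavy pairs exist only for `β ≤ 1/4`, the range in which `exp_failure_le` applies. -/
theorem weight_mul_weight_le [IsProbabilityMeasure P] (S : DFFStream R ε P) {i j : Fin m}
    (hij : i ≠ j) : S.weight i * S.weight j ≤ 1 / 4 := by
  have h : S.weight i + S.weight j ≤ 1 := by
    rw [← Finset.sum_pair hij]
    exact (Finset.sum_le_sum_of_subset_of_nonneg (Finset.subset_univ _)
      fun i _ _ => S.weight_nonneg i).trans S.sum_weight_le_one
  nlinarith [sq_nonneg (S.weight i - S.weight j), S.weight_nonneg i, S.weight_nonneg j]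

/-- The probability that the discriminative feature of some heavy pair of components is not found. -/
theorem measure_iUnion_rarePair_le [IsProbabilityMeasure P] (S : DFFStream R ε P) {β δ : ℝ}
    {N : ℕ} (hβ0 : 0 < β) (hδ0 : 0 < δ) (hδ1 : δ < 1)
    (hN : 12 * Real.log (1 / (2 * δ * β)) / β ≤ 2 * N + 1) :
    P (⋃ p ∈ Finset.univ.filter fun p : Fin m × Fin m =>
        p.1 < p.2 ∧ β ≤ S.weight p.1 * S.weight p.2, S.rarePair N (β * N) p.1 p.2) ≤
      ENNReal.ofReal δ := by
  have hnn : ∀ p : Fin m × Fin m, 0 ≤ 2 * (S.weight p.1 * S.weight p.2) := fun p =>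
    mul_nonneg zero_le_two (mul_nonneg (S.weight_nonneg _) (S.weight_nonneg _))
  refine (measure_biUnion_finset_le _ _).trans ?_
  calc _ ≤ ∑ p : Fin m × Fin m with p.1 < p.2 ∧ β ≤ S.weight p.1 * S.weight p.2,
        ENNReal.ofReal (δ * (2 * (S.weight p.1 * S.weight p.2))) := by
        refine Finset.sum_le_sum fun p hp => ?_
        obtain ⟨-, hlt, hβ⟩ := Finset.mem_filter.1 hp
        rw [← ofReal_measureReal (μ := P)]
        exact ENNReal.ofReal_le_ofReal ((S.measureReal_rarePair_le N _ hlt.ne).trans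
          (exp_failure_le hβ0 (hβ.trans (S.weight_mul_weight_le hlt.ne)) hδ0 hδ1 hβ hN))
    _ = ENNReal.ofReal (δ * ∑ p : Fin m × Fin m with
          p.1 < p.2 ∧ β ≤ S.weight p.1 * S.weight p.2, 2 * (S.weight p.1 * S.weight p.2)) := by
        rw [Finset.mul_sum, ENNReal.ofReal_sum_of_nonneg fun p _ => mul_nonneg hδ0.le (hnn p)]
    _ ≤ ENNReal.ofReal δ := by
        refine ENNReal.ofReal_le_ofReal (mul_le_of_le_one_right hδ0.le ?_)
        calc _ ≤ ∑ p : Fin m × Fin m with p.1 < p.2, 2 * (S.weight p.1 * S.weight p.2) :=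
              Finset.sum_le_sum_of_subset_of_nonneg
                (Finset.monotone_filter_right _ fun p _ hp => hp.1) fun p _ _ => hnn p
          _ ≤ (∑ i, S.weight i) ^ 2 := sum_lt_two_mul_le_sq S.weight_nonneg
          _ ≤ 1 := pow_le_one₀ (Finset.sum_nonneg fun i _ => S.weight_nonneg i)
              S.sum_weight_le_one

theorem consecutivePairsProtocol_outputs (S : DFFStream R ε P) (N : ℕ) (β : ℝ) (ω : Ω) :
    (consecutivePairsProtocol X Y N β).Outputs S ω ((consecutivePairsProtocol X Y N β).output
      ((consecutivePairsProtocol X Y N β).history S ω (2 * N))) := by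
  refine ⟨2 * N, fun k hk hh => ?_, ?_, rfl⟩
  · change 2 * N ≤ _ at hh
    rw [FeatureDiscoveryProtocol.length_history] at hh
    omega
  · change 2 * N ≤ _
    rw [FeatureDiscoveryProtocol.length_history]

end DFFStream

theorem mainTheorem3 {X : Type u} {Y : Type v} [MeasurableSpace X] [Fintype Y]
    [MeasurableSpace Y] [MeasurableSingletonClass Y] (m : ℕ) (β δ ε : ℝ)
    (hβ0 : 0 < β) (hβ1 : β < 1) (hδ0 : 0 < δ) (hδ1 : δ < 1) (hε0 : 0 < ε) (hε1 : ε < 1) :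
    HasFeatureInfluence.{u, v, w} (decisionListClass X Y m) m (Real.sqrt β * (m : ℝ) ^ 2 / 2) ε δ
      ⌊12 * Real.log (1 / (2 * δ * β)) / β⌋₊
      ((m : ℝ) * Real.logb 2 (max m (Fintype.card Y) : ℕ) +
        (m : ℝ) ^ 2 * Real.logb 2 (3 / β)) := by
  set B := 12 * Real.log (1 / (2 * δ * β)) / β
  -- Chosen so that the at most `2 * N - 1` mistakes fit into `⌊B⌋₊`, while `2 * N + 1` still
  -- reaches `B`.
  set N := (⌊B⌋₊ + 1) / 2 with hNdef
  have hN : B ≤ 2 * N + 1 := by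
    have h1 : ⌊B⌋₊ ≤ 2 * N := by omega
    have h2 : (⌊B⌋₊ : ℝ) ≤ 2 * N := by exact_mod_cast h1
    linarith [(Nat.lt_floor_add_one B).le]
  refine ⟨consecutivePairsProtocol X Y N β, fun Φ hΦ _ R Ω _ P _ S => ⟨?_, ?_, ?_⟩⟩
  · intro ω n hn
    refine (FeatureDiscoveryProtocol.mistakes_history_le _ S ω n).trans ?_
    have : n ≤ 2 * N := by
      by_contra hlt
      refine hn (2 * N) (not_le.1 hlt) ?_
      change 2 * N ≤ _
      rw [FeatureDiscoveryProtocol.length_history]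
    omega
  -- The teacher's features need not be measurable, so the failure event is covered by events about
  -- the triples only.
  · refine (measure_mono fun ω hω => ?_).trans
      (S.measure_iUnion_rarePair_le (N := N) hβ0 hδ0 hδ1 hN)
    by_contra hgood
    refine hω ⟨_, S.consecutivePairsProtocol_outputs N β ω,
      S.classErr_decisionListClass_le (β := β) hε0.le fun i j hl hβ => ?_⟩
    have hnot : ∀ i j, i < j → β ≤ S.weight i * S.weight j →
        ω ∉ S.rarePair N (β * N) i j := fun i j hlt hβ hr =>
      hgood (Set.mem_biUnion (x := (i, j))
        (by simpa using ⟨hlt, hβ⟩) hr)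
    rcases lt_trichotomy i j with hlt | rfl | hlt
    · exact S.disc_mem_output hβ0.le hl (hnot i j hlt hβ) le_rfl
    · exact absurd rfl hl
    -- The union bound ran over `i < j` only; the reverse direction follows because the output is
    -- closed under negation.
    · have := S.disc_mem_output hβ0.le hl.symm (hnot j i hlt (by rwa [mul_comm])) le_rfl
      rw [R.disc_neg j i hl.symm]
      exact ⟨by rw [featureCount_neg]; exact this.1, by rw [featureCount_neg]; exact this.2⟩
  · refine Filter.Eventually.of_forall fun ω => ⟨_, S.consecutivePairsProtocol_outputs N β ω,
      S.output_subset hΦ N β ω le_rfl, ?_⟩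
    have : Nonempty X := ⟨S.x 0 ω⟩
    have hfin := finite_frequentFeatures
      (fun k => ((consecutivePairsProtocol X Y N β).history S ω (2 * N))[2 * k + 1]?.bind
        Round.feature) N (β * N)
    refine ⟨(finite_decisionListClass_and_ncard_le m hfin).1,
      logb_ncard_decisionListClass_le m hfin ?_⟩
    refine (add_le_add (ncard_frequentFeatures_le _ N hβ0) le_rfl).trans ?_
    rw [← sub_nonneg, show 3 / β - (2 / β + 1) = (1 - β) / β by field_simp; ring]
    exact div_nonneg (by linarith) hβ0.le
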